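/- Fix integers $d\ge 1$ and $m\ge 0$. Let $\{h_\eta:\eta\in\Lambda\}$, with $\Lambda\subseteq\mathbb R^m$ open, be a family of probability densities on $\mathbb R$ with $\int x\,h_\eta(x)\,dx=0$ and $0<\int x^2h_\eta(x)\,dx<\infty$. For $k=1,\dots,d$ let $\{f^{(k)}_\theta:\theta\in\Theta_k\}$, with $\Theta_k\subseteq\mathbb R^k$ open, be families of probability densities on $\mathbb R$ which are nested: every member of the $k$-th family is a member of the $(k+1)$-st. Let $f_0$ be a density and let $\theta_0^{(k)}\in\Theta_k$ satisfy $f^{(k)}_{\theta_0^{(k)}}=f_0$ for every $k$. Put $g_k(y;(\theta,\eta))=\int_{\mathbb R} f^{(k)}_\theta(s)\,h_\eta(y-s)\,ds$, let $G_{k,(\theta,\eta)}$ be the distribution with density $g_k(\cdot\,;(\theta,\eta))$ and $G^n_{k,(\theta,\eta)}$ its $n$-fold product. The score is $$\dot l_{k,(\theta,\eta)}(y)=\frac{\nabla_{(\theta,\eta)}\,g_k(y;(\theta,\eta))}{g_k(y;(\theta,\eta))}\,1_{\{g_k(y;(\theta,\eta))>0\}}=(\dot l_\theta(y),\dot l_\eta(y)),$$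 and the Fisher information is $I_k(\theta,\eta)=\int \dot l\,\dot l^{\,T}\,dG_{k,(\theta,\eta)}$, with blocks $I_{11},I_{12},I_{21},I_{22}$. Assume that for every $k=1,\dots,d$ the problem is regular: (A1) for Lebesgue-almost every $y$, $g_k(y;\cdot)$ is continuously differentiable on $\Theta_k\times\Lambda$; (A2) $|\dot l_{k,(\theta,\eta)}|\in L_2(G_{k,(\theta,\eta)})$ for all $(\theta,\eta)\in\Theta_k\times\Lambda$; (A3) $I_k$ is nonsingular and continuous on $\Theta_k\times\Lambda$. Let $\eta_0\in\Lambda$. Let $l^{*(k)}=\dot l_\theta-I_{12}I_{22}^{-1}\dot l_\eta$, evaluated at $(\theta_0^{(k)},\eta_0)$, be the efficient score function for $\theta$ in the $k$-th model, and let $I^{*(k)}=\int l^{*(k)}\,l^{*(k)T}\,dG_{k,(\theta_0^{(k)},\eta_0)}$ be the efficient information matrix. Let $X_1,X_2,\dots$ be i.i.d. with density $f_0$ and $\varepsilon_1,\varepsilon_2,\dots$ i.i.d. with density $h_{\eta_0}$, all independent, and let $Y_j=X_j+\varepsilon_j$; write $P_{\theta_0,\eta_0}$ for the underlying probability. For each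 $k=1,\dots,d$ let $\hat l^{(k)}_{j}\in\mathbb R^k$ ($j\le n$) and $\hat L_k\in\mathbb R^{k\times k}$ be measurable functions of $Y_1,\dots,Y_n$ such that, as $n\to\infty$, $$\frac1{\sqrt n}\Bigl\|\sum_{j=1}^n\bigl(\hat l^{(k)}_{j}-l^{*(k)}(Y_j)\bigr)\Bigr\|\to0\quad\text{and}\quad \hat L_k\to (I^{*(k)})^{-1}\qquad\text{in } G^n_{k,(\theta_0^{(k)},\eta_0)}\text{-probability}.$$ Put $$W_k=\Bigl(\frac1{\sqrt n}\sum_{j=1}^n\hat l^{(k)}_{j}\Bigr)^{T}\hat L_k\,\Bigl(\frac1{\sqrt n}\sum_{j=1}^n\hat l^{(k)}_{j}\Bigr).$$ Let $\pi:\mathbb N\times\mathbb N\to\mathbb R$ satisfy $\pi(1,n)<\dots<\pi(d,n)$ for all $n\ge1$ and $\pi(j,n)-\pi(1,n)\to\infty$ as $n\to\infty$ for $j=2,\dots,d$, and let $$S=S(l^*)=\min\{k:1\le k\le d,\ W_k-\pi(k,n)\ge W_j-\pi(j,n)\ \text{for } j=1,\dots,d\}.$$ Then, as $n\to\infty$,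 $$P_{\theta_0,\eta_0}\bigl(S(l^*)>1\bigr)\to0\qquad\text{and}\qquad W_S\to_d\chi^2_1,$$ where $\chi^2_1$ is the chi-square distribution with one degree of freedom. -/

import Mathlib

open MeasureTheory ProbabilityTheory Filter Topology Set Matrix

noncomputable section

namespace Deconv

/-- `f` is a probability density on the real line with respect to Lebesgue measure. -/
structure IsDensity (f : ℝ → ℝ) : Prop where
  measurable : Measurable f
  nonneg : ∀ x, 0 ≤ f x
  integrable : Integrable f
  integral_eq_one : ∫ x, f x = 1

/-- The probability measure on the real line with Lebesgue density `f`. -/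
def lawOf (f : ℝ → ℝ) : Measure ℝ :=
  volume.withDensity (fun x => ENNReal.ofReal (f x))

/-- A `k`-dimensional parametric family `f_θ`, `θ ∈ Θ`, of densities of the signal `X`,
with open parameter set `Θ ⊆ ℝᵏ`. -/
structure SignalFamily (k : ℕ) where
  Θ : Set (Fin k → ℝ)
  f : (Fin k → ℝ) → ℝ → ℝ
  isOpen : IsOpen Θ
  isDensity : ∀ θ ∈ Θ, IsDensity (f θ)

/-- An `m`-dimensional parametric family `h_η`, `η ∈ Λ`, of densities of the error `ε`, with open
parameter set `Λ ⊆ ℝᵐ`; the error has mean zero and finite positive second moment. -/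
structure ErrorFamily (m : ℕ) where
  Λ : Set (Fin m → ℝ)
  h : (Fin m → ℝ) → ℝ → ℝ
  isOpen : IsOpen Λ
  isDensity : ∀ η ∈ Λ, IsDensity (h η)
  integrable_sq : ∀ η ∈ Λ, Integrable (fun x => x ^ 2 * h η x)
  second_moment_pos : ∀ η ∈ Λ, 0 < ∫ x, x ^ 2 * h η x
  mean_zero : ∀ η ∈ Λ, ∫ x, x * h η x = 0

section Model

variable {k m : ℕ} (F : SignalFamily k) (H : ErrorFamily m)

/-- The parameter set `Θ × Λ`. -/
def params : Set ((Fin k → ℝ) × (Fin m → ℝ)) := F.Θ ×ˢ H.Λ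

/-- The density `g(y; (θ, η)) = ∫ f_θ(s) h_η(y - s) ds` of an observation `Y = X + ε`. -/
def g (p : (Fin k → ℝ) × (Fin m → ℝ)) (y : ℝ) : ℝ :=
  ∫ s, F.f p.1 s * H.h p.2 (y - s)

/-- The law `G_{θ, η}` of one observation. -/
def G (p : (Fin k → ℝ) × (Fin m → ℝ)) : Measure ℝ := lawOf (g F H p)

/-- The law `Gⁿ_{θ, η}` of `n` independent observations. -/
def Gn (p : (Fin k → ℝ) × (Fin m → ℝ)) (n : ℕ) : Measure (Fin n → ℝ) :=
  Measure.pi (fun _ => G F H p)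

/-- The coordinate directions of the joint parameter `(θ, η)`. -/
def dir : Fin k ⊕ Fin m → (Fin k → ℝ) × (Fin m → ℝ)
  | Sum.inl i => (Pi.single i 1, 0)
  | Sum.inr i => (0, Pi.single i 1)

open Classical in
/-- The score function for `(θ, η)` at `p`: the gradient of `g(y; ·)` at `p`, divided by
`g(y; p)`, on the set where `g(y; p) > 0`, and zero elsewhere. -/
def score (p : (Fin k → ℝ) × (Fin m → ℝ)) (y : ℝ) (a : Fin k ⊕ Fin m) : ℝ :=
  if 0 < g F H p y then fderiv ℝ (fun q => g F H q y) p (dir a) / g F H p y else 0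

/-- The Fisher information matrix of the joint parameter `(θ, η)`. -/
def fisher (p : (Fin k → ℝ) × (Fin m → ℝ)) : Matrix (Fin k ⊕ Fin m) (Fin k ⊕ Fin m) ℝ :=
  Matrix.of fun a b => ∫ y, score F H p y a * score F H p y b ∂(G F H p)

/-- Regular deconvolution problem: the density is continuously differentiable in the parameter for
almost every `y`, the score is square integrable, and the Fisher information is nonsingular and
continuous. -/
structure IsRegular : Prop where
  contDiff : ∀ᵐ y : ℝ, ContDiffOn ℝ 1 (fun p => g F H p y) (params F H)
  memLp_score : ∀ p ∈ params F H,
    MemLp (fun y => WithLp.toLp 2 (score F H p y)) 2 (G F H p)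
  nonsingular : ∀ p ∈ params F H, IsUnit (fisher F H p).det
  continuous : ContinuousOn (fisher F H) (params F H)

/-- The efficient score function for `θ`: `l_θ - I₁₂ I₂₂⁻¹ l_η`. -/
def effScore (p : (Fin k → ℝ) × (Fin m → ℝ)) (y : ℝ) : Fin k → ℝ :=
  (fun i => score F H p y (Sum.inl i)) -
    ((fisher F H p).toBlocks₁₂ * (fisher F H p).toBlocks₂₂⁻¹) *ᵥ
      (fun j => score F H p y (Sum.inr j))

/-- The efficient Fisher information matrix for `θ`. -/
def effFisher (p : (Fin k → ℝ) × (Fin m → ℝ)) : Matrix (Fin k) (Fin k) ℝ :=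
  Matrix.of fun i j => ∫ y, effScore F H p y i * effScore F H p y j ∂(G F H p)

/-- Estimators `l*_1, …, l*_n` of the efficient scores at the observations, as functions of the
observations: they are sufficiently good at `p` if `n^{-1/2} ‖∑ⱼ (l*_j - l*(Y_j))‖` tends to zero in
`Gⁿ_p`-probability, with the Euclidean norm. -/
def SufficientlyGoodAt (p : (Fin k → ℝ) × (Fin m → ℝ))
    (l : (n : ℕ) → (Fin n → ℝ) → Fin n → Fin k → ℝ) : Prop :=
  ∀ r : ℝ, 0 < r → Tendsto
    (fun n : ℕ => Gn F H p n
      {y | r ≤ (1 / √(n : ℝ)) * ‖WithLp.toLp 2 (∑ j, (l n y j - effScore F H p (y j)))‖})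
    atTop (𝓝 0)

/-- The matrix estimator `L`, a function of the observations, is consistent at `p` for the inverse
of the efficient Fisher information. -/
def ConsistentAt (p : (Fin k → ℝ) × (Fin m → ℝ))
    (L : (n : ℕ) → (Fin n → ℝ) → Matrix (Fin k) (Fin k) ℝ) : Prop :=
  ∀ i j, ∀ r : ℝ, 0 < r → Tendsto
    (fun n : ℕ => Gn F H p n {y | r ≤ |L n y i j - (effFisher F H p)⁻¹ i j|})
    atTop (𝓝 0)

end Model

/-- The submodels of dimensions `1, …, d` are nested: every member of the `k`-th family is a member
of the `(k+1)`-st one. -/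
def IsNested (d : ℕ) (F : (k : ℕ) → SignalFamily k) : Prop :=
  ∀ k, 1 ≤ k → k < d → ∀ θ ∈ (F k).Θ, ∃ θ' ∈ (F (k + 1)).Θ, (F (k + 1)).f θ' = (F k).f θ

/-- The normalized sum `n^{-1/2} ∑ⱼ l_j`. -/
def normSum {k n : ℕ} (l : Fin n → Fin k → ℝ) : Fin k → ℝ :=
  (1 / √(n : ℝ)) • ∑ j, l j

/-- The efficient score test statistic: the quadratic form of `L` at the normalized sum of the
estimated efficient scores. -/
def scoreStat {k n : ℕ} (l : Fin n → Fin k → ℝ) (L : Matrix (Fin k) (Fin k) ℝ) : ℝ :=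
  normSum l ⬝ᵥ (L *ᵥ normSum l)

/-- A penalty for the models of dimensions `1, …, d`. -/
structure IsPenalty (d : ℕ) (pen : ℕ → ℕ → ℝ) : Prop where
  strictMono : ∀ n, 1 ≤ n → ∀ i j, 1 ≤ i → i < j → j ≤ d → pen i n < pen j n
  tendsto : ∀ j, 2 ≤ j → j ≤ d → Tendsto (fun n => pen j n - pen 1 n) atTop atTop

/-- The selection rule: the smallest `k` in `1, …, d` maximizing `W_k - π(k, n)`, where `w` and
`c` are the functions `k ↦ W_k` and `k ↦ π(k, n)`. -/
def selectionRule (d : ℕ) (w c : ℕ → ℝ) : ℕ :=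
  sInf {k | 1 ≤ k ∧ k ≤ d ∧ ∀ j, 1 ≤ j → j ≤ d → w j - c j ≤ w k - c k}

/-- The chi-square distribution with `k` degrees of freedom: the law of the sum of squares of `k`
independent standard normal variables. -/
def chiSquare (k : ℕ) : Measure ℝ :=
  (Measure.pi (fun _ : Fin k => gaussianReal 0 1)).map (fun z => ∑ i, z i ^ 2)

instance (k : ℕ) : IsProbabilityMeasure (chiSquare k) :=
  Measure.isProbabilityMeasure_map
    (Finset.measurable_sum _ fun i _ => (measurable_pi_apply i).pow_const 2).aemeasurable

end Deconv

end

/-! By nestedness of the null value the law of `Y` belongs to every submodel. If each efficient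
score at the truth is centered and square integrable, its normalized sums are bounded in probability
by Chebyshev. So are the estimated ones, and since the matrix estimators converge, every `W_k` is
bounded in probability. If `S = k > 1`, maximality at `k` forces `|W_k| + |W_1| ≥ π(k,n) - π(1,n)`,
and the right side tends to infinity; hence `S = 1` with probability tending to one. Then `W_S`
agrees with `W_1`, and for `k = 1` the central limit theorem and Slutsky give the limit `(√I* Z)² /
I* = Z²` with `Z` standard normal.

Two facts must be extracted from regularity. Positivity of `I*` in dimension one follows from
nonsingularity of the Fisher information (`IsRegular.effFisher_diag_pos`). Centering of the score
(`IsRegular.integral_score`) needs differentiation under the integral without a dominating function.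
Along a path `q t` of densities with derivative `D t`, Fubini shows that `∫ D t` has zero mean over
every time interval, so it is nonpositive at times arbitrarily close to `0`. Fatou, with continuity
of the Fisher information in place of domination, carries the sign to `t = 0`; time reversal gives
the opposite sign. -/

namespace Deconv

/-! ### Derivatives of density paths with continuous Fisher information -/

section MeanZero

variable {α : Type*} {q D : ℝ → α → ℝ}

lemma deriv_eq_zero_of_nonneg (hq0 : ∀ t y, 0 ≤ q t y)
    (hD : ∀ t y, HasDerivAt (fun s => q s y) (D t y) t) {t : ℝ} {y : α} (h : q t y = 0) :
    D t y = 0 := by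
  have hmin : IsLocalMin (fun s => q s y) t :=
    Eventually.of_forall fun s => by simpa [h] using hq0 s y
  exact hmin.hasDerivAt_eq_zero (hD t y)

/-- Arithmetic-geometric mean inequality. At `b = 0` the quotient has the value `0`, so `a = 0` is
needed there. With `a = D t y` and `b = q t y` it bounds `|D|` by integrable functions. -/
lemma abs_le_sq_div_add {a b : ℝ} (hb : 0 ≤ b) (h : b = 0 → a = 0) :
    |a| ≤ (a ^ 2 / b + b) / 2 := by
  rcases hb.eq_or_lt with hb | hb
  · simp [h hb.symm, ← hb]
  · have h1 : a ^ 2 / b + b - 2 * |a| = (|a| - b) ^ 2 / b := by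
      rw [← sq_abs a]; field_simp; ring
    have h2 : 0 ≤ (|a| - b) ^ 2 / b := by positivity
    linarith

variable [MeasurableSpace α] {μ : Measure α}

lemma measurable_of_hasDerivAt_param (hq : ∀ t, Measurable (q t))
    (hD : ∀ t y, HasDerivAt (fun s => q s y) (D t y) t) (t : ℝ) : Measurable (D t) := by
  have hu : Tendsto (fun n : ℕ => t + 1 / ((n : ℝ) + 1)) atTop (𝓝[≠] t) := by
    refine tendsto_nhdsWithin_iff.2 ⟨?_, Eventually.of_forall fun n => ?_⟩
    · simpa using tendsto_const_nhds.add (tendsto_one_div_add_atTop_nhds_zero_nat (𝕜 := ℝ))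
    · have : (0 : ℝ) < 1 / ((n : ℝ) + 1) := by positivity
      simp only [mem_compl_iff, mem_singleton_iff]
      linarith
  refine measurable_of_tendsto_metrizable
    (f := fun (n : ℕ) y => slope (fun s => q s y) t (t + 1 / ((n : ℝ) + 1))) (fun n => ?_) ?_
  · simp only [slope_def_field]
    exact ((hq _).sub (hq _)).div_const _
  · exact tendsto_pi_nhds.2 fun y => (hasDerivAt_iff_tendsto_slope.1 (hD t y)).comp hu

lemma integrable_of_fisher (hq : ∀ t, Measurable (q t)) (hq0 : ∀ t y, 0 ≤ q t y)
    (hqi : ∀ t, Integrable (q t) μ) (hD : ∀ t y, HasDerivAt (fun s => q s y) (D t y) t)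
    (hU : ∀ t, Integrable (fun y => D t y ^ 2 / q t y) μ) (t : ℝ) : Integrable (D t) μ := by
  refine (((hU t).add (hqi t)).div_const 2).mono'
    (measurable_of_hasDerivAt_param hq hD t).aestronglyMeasurable (ae_of_all _ fun y => ?_)
  exact abs_le_sq_div_add (hq0 t y) fun h => deriv_eq_zero_of_nonneg hq0 hD h

/-- Continuity of the Fisher information makes the bound on `|D|` integrable over bounded time
intervals, so Fubini applies; the inner time integral is `q b y - q a y`, whose total mass is `c -
c`. -/
lemma intervalIntegral_integral_deriv_eq [SFinite μ] (hq : ∀ t, Measurable (q t))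
    (hq0 : ∀ t y, 0 ≤ q t y) {c : ℝ}
    (hqi : ∀ t, Integrable (q t) μ) (hqc : ∀ t, ∫ y, q t y ∂μ = c)
    (hD : ∀ t y, HasDerivAt (fun s => q s y) (D t y) t)
    (hDc : ∀ y, Continuous fun t => D t y)
    (hU : ∀ t, Integrable (fun y => D t y ^ 2 / q t y) μ)
    (hJ : Continuous fun t => ∫ y, D t y ^ 2 / q t y ∂μ) (a b : ℝ) :
    IntervalIntegrable (fun t => ∫ y, D t y ∂μ) volume a b ∧
      ∫ t in a..b, ∫ y, D t y ∂μ = 0 := by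
  have hDm := measurable_of_hasDerivAt_param hq hD
  have hDi := integrable_of_fisher hq hq0 hqi hD hU
  have hDu : Measurable (Function.uncurry D) := measurable_uncurry_of_continuous_of_measurable hDc hDm
  have hprod : Integrable (Function.uncurry D) ((volume.restrict (uIoc a b)).prod μ) := by
    refine (integrable_prod_iff hDu.aestronglyMeasurable).2 ⟨ae_of_all _ fun t => hDi t, ?_⟩
    have hbound : Integrable (fun t => ((∫ y, D t y ^ 2 / q t y ∂μ) + c) / 2)
        (volume.restrict (uIoc a b)) :=
      intervalIntegrable_iff.1 (((hJ.add continuous_const).div_const 2).intervalIntegrable a b)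
    refine hbound.mono' ?_ (ae_of_all _ fun t => ?_)
    · exact (hDu.norm.stronglyMeasurable.integral_prod_right').aestronglyMeasurable
    · rw [Real.norm_of_nonneg (integral_nonneg fun y => norm_nonneg _), ← hqc t,
        ← integral_add (hU t) (hqi t), ← integral_div]
      exact integral_mono (hDi t).norm (((hU t).add (hqi t)).div_const 2) fun y =>
        abs_le_sq_div_add (hq0 t y) fun h => deriv_eq_zero_of_nonneg hq0 hD h
  refine ⟨intervalIntegrable_iff.2 hprod.integral_prod_left, ?_⟩
  rw [intervalIntegral_integral_swap hprod]
  have : ∀ y, ∫ t in a..b, D t y = q b y - q a y := fun y =>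
    intervalIntegral.integral_eq_sub_of_hasDerivAt (fun t _ => hD t y)
      ((hDc y).intervalIntegrable a b)
  simp_rw [this]
  rw [integral_sub (hqi b) (hqi a), hqc, hqc, sub_self]

/-- Fatou is applied to `D` plus its integrable bound. The integral of that bound is continuous in
`t`, so it cancels in the limit and leaves lower semicontinuity of `∫ D t` at `0`. -/
lemma integral_deriv_nonpos_of_fisher [SFinite μ] (hq : ∀ t, Measurable (q t))
    (hq0 : ∀ t y, 0 ≤ q t y) {c : ℝ}
    (hqi : ∀ t, Integrable (q t) μ) (hqc : ∀ t, ∫ y, q t y ∂μ = c)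
    (hD : ∀ t y, HasDerivAt (fun s => q s y) (D t y) t)
    (hDc : ∀ y, Continuous fun t => D t y)
    (hU : ∀ t, Integrable (fun y => D t y ^ 2 / q t y) μ)
    (hJ : Continuous fun t => ∫ y, D t y ^ 2 / q t y ∂μ) :
    ∫ y, D 0 y ∂μ ≤ 0 := by
  have hDm := measurable_of_hasDerivAt_param hq hD
  have hDi := integrable_of_fisher hq hq0 hqi hD hU
  -- Were `∫ D t` positive on the whole interval, its time integral would be positive rather than
  -- `0`.
  have hex : ∀ n : ℕ, ∃ t ∈ Ioo (0 : ℝ) (1 / ((n : ℝ) + 1)), ∫ y, D t y ∂μ ≤ 0 := by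
    intro n
    by_contra! hcon
    obtain ⟨h1, h2⟩ := intervalIntegral_integral_deriv_eq hq hq0 hqi hqc hD hDc hU hJ 0
      (1 / ((n : ℝ) + 1))
    exact (intervalIntegral.intervalIntegral_pos_of_pos_on h1 hcon (by positivity)).ne' h2
  choose t ht htn using hex
  have ht0 : Tendsto t atTop (𝓝 0) :=
    squeeze_zero (fun n => (ht n).1.le) (fun n => (ht n).2.le)
      tendsto_one_div_add_atTop_nhds_zero_nat
  set A : ℝ → α → ℝ := fun s y => (D s y ^ 2 / q s y + q s y) / 2 + D s y with hA
  have hA0 : ∀ s y, 0 ≤ A s y := fun s y => by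
    have := abs_le_sq_div_add (hq0 s y) fun h => deriv_eq_zero_of_nonneg hq0 hD h
    have := neg_abs_le (D s y)
    simp only [hA]; linarith
  have hAi : ∀ s, Integrable (A s) μ := fun s => (((hU s).add (hqi s)).div_const 2).add (hDi s)
  have hAint : ∀ s, ∫ y, A s y ∂μ = ((∫ y, D s y ^ 2 / q s y ∂μ) + c) / 2 + ∫ y, D s y ∂μ := by
    intro s
    simp only [hA]
    refine (integral_add (((hU s).add (hqi s)).div_const 2) (hDi s)).trans ?_
    refine congrArg (· + ∫ y, D s y ∂μ) ((integral_div _ _).trans (congrArg (· / 2) ?_))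
    exact (integral_add (hU s) (hqi s)).trans (by rw [hqc])
  have hlim : ∀ y, ENNReal.ofReal (A 0 y) ≤ liminf (fun n => ENNReal.ofReal (A (t n) y)) atTop := by
    intro y
    -- Where `q 0 y = 0` the quotient need not converge, but `A 0 y = 0` and Fatou only needs an
    -- inequality.
    rcases (hq0 0 y).eq_or_lt with h | h
    · simp [hA, ← h, deriv_eq_zero_of_nonneg hq0 hD h.symm]
    · have hqt : Tendsto (fun n => q (t n) y) atTop (𝓝 (q 0 y)) :=
        (hD 0 y).continuousAt.tendsto.comp ht0
      have hDt : Tendsto (fun n => D (t n) y) atTop (𝓝 (D 0 y)) := ((hDc y).tendsto 0).comp ht0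
      have : Tendsto (fun n => A (t n) y) atTop (𝓝 (A 0 y)) :=
        ((((hDt.pow 2).div hqt h.ne').add hqt).div_const 2).add hDt
      exact (ENNReal.tendsto_ofReal this).liminf_eq.ge
  have key : ENNReal.ofReal (∫ y, A 0 y ∂μ) ≤
      ENNReal.ofReal (((∫ y, D 0 y ^ 2 / q 0 y ∂μ) + c) / 2) := by
    calc ENNReal.ofReal (∫ y, A 0 y ∂μ) = ∫⁻ y, ENNReal.ofReal (A 0 y) ∂μ :=
          ofReal_integral_eq_lintegral_ofReal (hAi 0) (ae_of_all _ (hA0 0))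
      _ ≤ ∫⁻ y, liminf (fun n => ENNReal.ofReal (A (t n) y)) atTop ∂μ := lintegral_mono hlim
      _ ≤ liminf (fun n => ∫⁻ y, ENNReal.ofReal (A (t n) y) ∂μ) atTop :=
          lintegral_liminf_le fun n =>
            ((((hDm _).pow_const 2).div (hq _)).add (hq _) |>.div_const 2 |>.add (hDm _)).ennreal_ofReal
      _ = liminf (fun n => ENNReal.ofReal (∫ y, A (t n) y ∂μ)) atTop := by
          congr 1; ext n
          rw [ofReal_integral_eq_lintegral_ofReal (hAi _) (ae_of_all _ (hA0 _))]
      _ ≤ liminf (fun n => ENNReal.ofReal (((∫ y, D (t n) y ^ 2 / q (t n) y ∂μ) + c) / 2)) atTop := by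
          refine liminf_le_liminf (Eventually.of_forall fun n => ENNReal.ofReal_le_ofReal ?_)
          rw [hAint]; linarith [htn n]
      _ = ENNReal.ofReal (((∫ y, D 0 y ^ 2 / q 0 y ∂μ) + c) / 2) :=
          (ENNReal.tendsto_ofReal
            ((((hJ.tendsto 0).comp ht0).add_const c).div_const 2)).liminf_eq
  have hc : 0 ≤ ((∫ y, D 0 y ^ 2 / q 0 y ∂μ) + c) / 2 := by
    have h1 : 0 ≤ ∫ y, D 0 y ^ 2 / q 0 y ∂μ :=
      integral_nonneg fun y => div_nonneg (sq_nonneg _) (hq0 0 y)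
    have h2 : 0 ≤ c := by rw [← hqc 0]; exact integral_nonneg (hq0 0)
    positivity
  have := (ENNReal.ofReal_le_ofReal_iff hc).1 key
  rw [hAint] at this
  linarith

lemma integral_deriv_eq_zero_of_fisher [SFinite μ] (hq : ∀ t, Measurable (q t))
    (hq0 : ∀ t y, 0 ≤ q t y) {c : ℝ}
    (hqi : ∀ t, Integrable (q t) μ) (hqc : ∀ t, ∫ y, q t y ∂μ = c)
    (hD : ∀ t y, HasDerivAt (fun s => q s y) (D t y) t)
    (hDc : ∀ y, Continuous fun t => D t y)
    (hU : ∀ t, Integrable (fun y => D t y ^ 2 / q t y) μ)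
    (hJ : Continuous fun t => ∫ y, D t y ^ 2 / q t y ∂μ) :
    ∫ y, D 0 y ∂μ = 0 := by
  refine le_antisymm (integral_deriv_nonpos_of_fisher hq hq0 hqi hqc hD hDc hU hJ) ?_
  -- The reversed path has derivative `-D (-t)`, so the one-sided bound gives the other inequality.
  have := integral_deriv_nonpos_of_fisher (μ := μ) (q := fun t => q (-t)) (D := fun t y => -D (-t) y)
    (c := c) (fun t => hq _) (fun t => hq0 _) (fun t => hqi _) (fun t => hqc _)
    (fun t y => by
      simpa [Function.comp_def] using (hD (-t) y).scomp t (hasDerivAt_neg t))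
    (fun y => ((hDc y).comp continuous_neg).neg)
    (fun t => by simpa using hU (-t)) (by simpa [Function.comp_def] using hJ.comp continuous_neg)
  simpa [integral_neg] using this

/-- Along a differentiable path of densities with continuous Fisher information, the derivative
of the density has integral zero. -/
lemma integral_deriv_eq_zero_of_fisher_ae [SFinite μ] (hq : ∀ t, Measurable (q t))
    (hq0 : ∀ t y, 0 ≤ q t y) {c : ℝ}
    (hqi : ∀ t, Integrable (q t) μ) (hqc : ∀ t, ∫ y, q t y ∂μ = c)
    (hD : ∀ᵐ y ∂μ, (∀ t, HasDerivAt (fun s => q s y) (D t y) t) ∧ Continuous fun t => D t y)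
    (hU : ∀ t, Integrable (fun y => D t y ^ 2 / q t y) μ)
    (hJ : Continuous fun t => ∫ y, D t y ^ 2 / q t y ∂μ) :
    ∫ y, D 0 y ∂μ = 0 := by
  -- Replacing `q` and `D` by `0` on a measurable null set makes the regularity hold for every `y`
  -- and changes no integral.
  obtain ⟨N, hN, hNm, hNae⟩ := exists_measurable_superset_of_null (ae_iff.1 hD)
  have hgood : ∀ᵐ y ∂μ, y ∈ Nᶜ := by simpa [ae_iff] using hNae
  have hqe : ∀ t, Nᶜ.indicator (q t) =ᵐ[μ] q t := fun t => by
    filter_upwards [hgood] with y hy using indicator_of_mem hy _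
  have hDe : ∀ t, Nᶜ.indicator (D t) =ᵐ[μ] D t := fun t => by
    filter_upwards [hgood] with y hy using indicator_of_mem hy _
  have hUe : ∀ t, (fun y => Nᶜ.indicator (D t) y ^ 2 / Nᶜ.indicator (q t) y) =ᵐ[μ]
      fun y => D t y ^ 2 / q t y := fun t => by
    filter_upwards [hqe t, hDe t] with y h1 h2
    rw [h1, h2]
  have hprop : ∀ y ∈ Nᶜ, (∀ t, HasDerivAt (fun s => q s y) (D t y) t) ∧
      Continuous fun t => D t y := fun y hy => by
    by_contra hcon
    exact hy (hN hcon)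
  rw [← integral_congr_ae (hDe 0)]
  refine integral_deriv_eq_zero_of_fisher (c := c) (q := fun t => Nᶜ.indicator (q t))
    (D := fun t => Nᶜ.indicator (D t)) (fun t => (hq t).indicator hNm.compl)
    (fun t y => indicator_nonneg (fun y _ => hq0 t y) y) (fun t => (hqi t).congr (hqe t).symm)
    (fun t => (integral_congr_ae (hqe t)).trans (hqc t)) (fun t y => ?_) (fun y => ?_)
    (fun t => (hU t).congr (hUe t).symm) ?_
  · by_cases hy : y ∈ Nᶜ
    · simpa [indicator_of_mem hy] using (hprop y hy).1 t
    · simpa [indicator_of_notMem hy] using hasDerivAt_const t (0 : ℝ)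
  · by_cases hy : y ∈ Nᶜ
    · simpa [indicator_of_mem hy] using (hprop y hy).2
    · simpa [indicator_of_notMem hy] using continuous_const
  · simpa only [integral_congr_ae (hUe _)] using hJ

end MeanZero

end Deconv

namespace Deconv

lemma IsDensity.isProbabilityMeasure_lawOf {f : ℝ → ℝ} (hf : IsDensity f) :
    IsProbabilityMeasure (lawOf f) := by
  refine ⟨?_⟩
  rw [lawOf, withDensity_apply _ MeasurableSet.univ, Measure.restrict_univ,
    ← ofReal_integral_eq_lintegral_ofReal hf.integrable (ae_of_all _ hf.nonneg),
    hf.integral_eq_one, ENNReal.ofReal_one]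

/-! ### The deconvolution model: observation law, centered scores, efficient information -/

section Model

variable {k m : ℕ} {F : SignalFamily k} {H : ErrorFamily m}
  {p : (Fin k → ℝ) × (Fin m → ℝ)}

lemma isOpen_params : IsOpen (params F H) := F.isOpen.prod H.isOpen

lemma measurable_g (hp : p ∈ params F H) : Measurable (g F H p) := by
  have hf := (F.isDensity _ hp.1).measurable
  have hh := (H.isDensity _ hp.2).measurable
  have : Measurable (Function.uncurry fun y s : ℝ => F.f p.1 s * H.h p.2 (y - s)) :=
    (hf.comp measurable_snd).mul (hh.comp (measurable_fst.sub measurable_snd))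
  exact this.stronglyMeasurable.integral_prod_right.measurable

lemma g_nonneg (hp : p ∈ params F H) (y : ℝ) : 0 ≤ g F H p y :=
  integral_nonneg fun s => mul_nonneg ((F.isDensity _ hp.1).nonneg s)
    ((H.isDensity _ hp.2).nonneg _)

/-- The convolution density is a Lebesgue integral in `[0, ∞]`, while `g` is a Bochner integral.
They agree where the former is finite, which is almost everywhere because the total mass is finite.
-/
lemma conv_lawOf_eq_G (hp : p ∈ params F H) :
    lawOf (F.f p.1) ∗ lawOf (H.h p.2) = G F H p := by
  have hf := F.isDensity _ hp.1
  have hh := H.isDensity _ hp.2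
  have := hf.isProbabilityMeasure_lawOf
  have := hh.isProbabilityMeasure_lawOf
  set φ : ℝ → ENNReal := fun x => ENNReal.ofReal (F.f p.1 x) with hφ
  set ψ : ℝ → ENNReal := fun x => ENNReal.ofReal (H.h p.2 x) with hψ
  have hφm : Measurable φ := hf.measurable.ennreal_ofReal
  have hψm : Measurable ψ := hh.measurable.ennreal_ofReal
  have hconv : lawOf (F.f p.1) ∗ lawOf (H.h p.2) = volume.withDensity (φ ⋆ₗ[volume] ψ) :=
    conv_withDensity_eq_lconvolution hφm hψm
  have hfin : ∀ᵐ y : ℝ, (φ ⋆ₗ[volume] ψ) y < ⊤ := by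
    refine ae_lt_top (measurable_lconvolution _ hφm hψm) ?_
    rw [← setLIntegral_univ, ← withDensity_apply _ MeasurableSet.univ, ← hconv]
    exact measure_ne_top _ _
  rw [hconv, G, lawOf]
  refine withDensity_congr_ae ?_
  filter_upwards [hfin] with y hy
  have hterm : ∀ s, φ s * ψ (-s + y) = ENNReal.ofReal (F.f p.1 s * H.h p.2 (y - s)) := fun s => by
    rw [ENNReal.ofReal_mul (hf.nonneg s), neg_add_eq_sub]
  have hmeas : Measurable fun s => F.f p.1 s * H.h p.2 (y - s) :=
    hf.measurable.mul (hh.measurable.comp (measurable_const.sub measurable_id))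
  have hnn : ∀ s, 0 ≤ F.f p.1 s * H.h p.2 (y - s) := fun s =>
    mul_nonneg (hf.nonneg s) (hh.nonneg _)
  rw [lconvolution_def] at hy ⊢
  simp_rw [hterm] at hy ⊢
  refine (ofReal_integral_eq_lintegral_ofReal ⟨hmeas.aestronglyMeasurable, ?_⟩
    (ae_of_all _ hnn)).symm
  rwa [hasFiniteIntegral_iff_ofReal (ae_of_all _ hnn)]

lemma isProbabilityMeasure_G (hp : p ∈ params F H) : IsProbabilityMeasure (G F H p) := by
  have := (F.isDensity _ hp.1).isProbabilityMeasure_lawOf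
  have := (H.isDensity _ hp.2).isProbabilityMeasure_lawOf
  rw [← conv_lawOf_eq_G hp]
  infer_instance

lemma integral_G (hp : p ∈ params F H) (φ : ℝ → ℝ) :
    ∫ y, φ y ∂(G F H p) = ∫ y, g F H p y * φ y := by
  rw [G, lawOf, integral_withDensity_eq_integral_toReal_smul (measurable_g hp).ennreal_ofReal
    (ae_of_all _ fun _ => ENNReal.ofReal_lt_top)]
  simp only [ENNReal.toReal_ofReal (g_nonneg hp _), smul_eq_mul]

lemma integrable_G_iff (hp : p ∈ params F H) {φ : ℝ → ℝ} :
    Integrable φ (G F H p) ↔ Integrable fun y => g F H p y * φ y := by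
  rw [G, lawOf, integrable_withDensity_iff_integrable_smul' (measurable_g hp).ennreal_ofReal
    (ae_of_all _ fun _ => ENNReal.ofReal_lt_top)]
  simp only [ENNReal.toReal_ofReal (g_nonneg hp _), smul_eq_mul]

lemma integrable_g (hp : p ∈ params F H) : Integrable (g F H p) := by
  have := isProbabilityMeasure_G hp
  simpa using (integrable_G_iff hp).1 (integrable_const (1 : ℝ))

lemma integral_g (hp : p ∈ params F H) : ∫ y, g F H p y = 1 := by
  have := isProbabilityMeasure_G hp
  simpa using (integral_G hp fun _ => (1 : ℝ)).symm

lemma fderiv_g_eq_zero (hp : p ∈ params F H) {y : ℝ} (h : g F H p y = 0) :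
    fderiv ℝ (fun q => g F H q y) p = 0 := by
  refine IsLocalMin.fderiv_eq_zero ?_
  filter_upwards [isOpen_params.mem_nhds hp] with q hq
  rw [h]
  exact g_nonneg hq y

/-- The truncation in the score costs nothing: a zero of `g` is a minimum in the parameter, so the
gradient vanishes there. -/
lemma g_mul_score (hp : p ∈ params F H) (y : ℝ) (a : Fin k ⊕ Fin m) :
    g F H p y * score F H p y a = fderiv ℝ (fun q => g F H q y) p (dir a) := by
  rcases (g_nonneg hp y).eq_or_lt with h | h
  · simp [← h, fderiv_g_eq_zero hp h.symm]
  · rw [score, if_pos h, mul_div_cancel₀ _ h.ne']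

lemma g_mul_score_sq (hp : p ∈ params F H) (y : ℝ) (a : Fin k ⊕ Fin m) :
    g F H p y * (score F H p y a * score F H p y a) =
      fderiv ℝ (fun q => g F H q y) p (dir a) ^ 2 / g F H p y := by
  rcases (g_nonneg hp y).eq_or_lt with h | h
  · simp [← h]
  · rw [score, if_pos h]
    field_simp

lemma IsRegular.memLp_score_apply (h : IsRegular F H) (hp : p ∈ params F H) (a : Fin k ⊕ Fin m) :
    MemLp (fun y => score F H p y a) 2 (G F H p) :=
  (h.memLp_score p hp).eval_piLp a

/-- The sine confines the path to a short segment for all real times, as the path lemmas require,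
while its velocity at `0` is the nonzero multiple `δ` of `v`. -/
lemma exists_sin_path_mem_params (hp : p ∈ params F H) (v : (Fin k → ℝ) × (Fin m → ℝ)) :
    ∃ δ : ℝ, 0 < δ ∧ ∀ t : ℝ, p + (δ * Real.sin t) • v ∈ params F H := by
  have hcont : Continuous fun s : ℝ => p + s • v := by fun_prop
  have hmem : (fun s : ℝ => p + s • v) ⁻¹' params F H ∈ 𝓝 (0 : ℝ) :=
    (isOpen_params.preimage hcont).mem_nhds (by simpa using hp)
  obtain ⟨δ, hδ, hball⟩ := Metric.mem_nhds_iff.1 hmem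
  refine ⟨δ / 2, by positivity, fun t => hball ?_⟩
  rw [mem_ball_zero_iff, Real.norm_eq_abs, abs_mul, abs_of_pos (half_pos hδ)]
  have := Real.abs_sin_le_one t
  nlinarith

/-- The score of a regular deconvolution problem is centered. -/
lemma IsRegular.integral_score (h : IsRegular F H) (hp : p ∈ params F H) (a : Fin k ⊕ Fin m) :
    ∫ y, score F H p y a ∂(G F H p) = 0 := by
  obtain ⟨δ, hδ, hpath⟩ := exists_sin_path_mem_params hp (dir a)
  set γ : ℝ → (Fin k → ℝ) × (Fin m → ℝ) := fun t => p + (δ * Real.sin t) • dir a with hγ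
  have hγc : Continuous γ := by fun_prop
  have hγd : ∀ t, HasDerivAt γ ((δ * Real.cos t) • dir a) t := fun t => by
    simpa [hγ] using (((Real.hasDerivAt_sin t).const_mul δ).smul_const (dir a)).const_add p
  set D : ℝ → ℝ → ℝ := fun t y => (δ * Real.cos t) *
    fderiv ℝ (fun q => g F H q y) (γ t) (dir a) with hD
  have hUeq : ∀ t y, D t y ^ 2 / g F H (γ t) y = (δ * Real.cos t) ^ 2 *
      (g F H (γ t) y * (score F H (γ t) y a * score F H (γ t) y a)) := fun t y => by
    rw [g_mul_score_sq (hpath t)]; simp only [hD]; ring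
  have hmain : ∫ y, D 0 y = 0 := by
    refine integral_deriv_eq_zero_of_fisher_ae (q := fun t => g F H (γ t)) (c := 1)
      (fun t => measurable_g (hpath t)) (fun t y => g_nonneg (hpath t) y)
      (fun t => integrable_g (hpath t)) (fun t => integral_g (hpath t)) ?_ (fun t => ?_) ?_
    · filter_upwards [h.contDiff] with y hy
      refine ⟨fun t => ?_, ?_⟩
      · have hd : HasFDerivAt (fun q => g F H q y) (fderiv ℝ (fun q => g F H q y) (γ t)) (γ t) :=
          ((hy.differentiableOn one_ne_zero).differentiableAt
            (isOpen_params.mem_nhds (hpath t))).hasFDerivAt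
        simpa [hD, Function.comp_def] using hd.comp_hasDerivAt t (hγd t)
      · have h1 : Continuous fun t => fderiv ℝ (fun q => g F H q y) (γ t) :=
          (hy.continuousOn_fderiv_of_isOpen isOpen_params le_rfl).comp_continuous hγc hpath
        exact (continuous_const.mul Real.continuous_cos).mul (h1.clm_apply continuous_const)
    · simp_rw [hUeq]
      refine Integrable.const_mul ((integrable_G_iff (hpath t)).1 ?_) _
      exact (h.memLp_score_apply (hpath t) a).integrable_mul (h.memLp_score_apply (hpath t) a)
    · have h1 : ∀ t, ∫ y, D t y ^ 2 / g F H (γ t) y =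
          (δ * Real.cos t) ^ 2 * fisher F H (γ t) a a := fun t => by
        simp_rw [hUeq]
        rw [integral_const_mul, ← integral_G (hpath t)]
        rfl
      simp_rw [h1]
      have h2 : Continuous fun t => fisher F H (γ t) := h.continuous.comp_continuous hγc hpath
      exact ((continuous_const.mul Real.continuous_cos).pow 2).mul (h2.matrix_elem a a)
  have hγ0 : γ 0 = p := by simp [hγ]
  rw [integral_G hp]
  simp_rw [g_mul_score hp]
  simp only [hD, hγ0, Real.cos_zero, mul_one, integral_const_mul] at hmain
  exact (mul_eq_zero.1 hmain).resolve_left hδ.ne'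

/-- The coefficients of the `i`-th efficient score as a combination of the scores. -/
noncomputable def effCoeff (F : SignalFamily k) (H : ErrorFamily m) (p : (Fin k → ℝ) × (Fin m → ℝ))
    (i : Fin k) : Fin k ⊕ Fin m → ℝ :=
  Sum.elim (Pi.single i 1)
    (-((fisher F H p).toBlocks₁₂ * (fisher F H p).toBlocks₂₂⁻¹) i)

lemma effScore_eq_sum (p : (Fin k → ℝ) × (Fin m → ℝ)) (y : ℝ) (i : Fin k) :
    effScore F H p y i = ∑ a, score F H p y a * effCoeff F H p i a := by
  simp [effScore, effCoeff, mulVec, dotProduct, Pi.single_apply, sub_eq_add_neg, mul_comm]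

lemma IsRegular.memLp_effScore (h : IsRegular F H) (hp : p ∈ params F H) (i : Fin k) :
    MemLp (fun y => effScore F H p y i) 2 (G F H p) := by
  simp_rw [effScore_eq_sum]
  exact memLp_finsetSum _ fun a _ => (h.memLp_score_apply hp a).mul_const _

lemma IsRegular.integral_effScore (h : IsRegular F H) (hp : p ∈ params F H) (i : Fin k) :
    ∫ y, effScore F H p y i ∂(G F H p) = 0 := by
  have := isProbabilityMeasure_G hp
  simp_rw [effScore_eq_sum]
  rw [integral_finsetSum _ fun a _ =>
    ((h.memLp_score_apply hp a).integrable one_le_two).mul_const _]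
  simp [integral_mul_const, h.integral_score hp]

/-- If the diagonal entry vanished, the efficient score would be almost surely zero, and its
coefficient vector would lie in the kernel of the Fisher matrix. That vector has entry `1` at
`Sum.inl i`, against nonsingularity. -/
lemma IsRegular.effFisher_diag_pos (h : IsRegular F H) (hp : p ∈ params F H) (i : Fin k) :
    0 < effFisher F H p i i := by
  have hnn : 0 ≤ effFisher F H p i i := integral_nonneg fun y => mul_self_nonneg _
  refine hnn.lt_of_ne fun h0 => ?_
  have hL := h.memLp_effScore hp i
  have hzero : (fun y => effScore F H p y i * effScore F H p y i) =ᵐ[G F H p] 0 :=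
    (integral_eq_zero_iff_of_nonneg (fun y => mul_self_nonneg _) (hL.integrable_mul hL)).1 h0.symm
  have hker : fisher F H p *ᵥ effCoeff F H p i = 0 := by
    ext a
    have hint : ∀ b ∈ Finset.univ, Integrable
        (fun y => score F H p y a * score F H p y b * effCoeff F H p i b) (G F H p) := fun b _ =>
      ((h.memLp_score_apply hp a).integrable_mul (h.memLp_score_apply hp b)).mul_const _
    have h1 : (fisher F H p *ᵥ effCoeff F H p i) a =
        ∫ y, score F H p y a * effScore F H p y i ∂(G F H p) := by
      simp_rw [effScore_eq_sum, Finset.mul_sum, ← mul_assoc]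
      rw [integral_finsetSum _ hint]
      simp [mulVec, dotProduct, fisher, integral_mul_const]
    rw [h1, Pi.zero_apply]
    refine integral_eq_zero_of_ae ?_
    filter_upwards [hzero] with y hy
    simp [mul_self_eq_zero.1 hy]
  have hc := Matrix.eq_zero_of_mulVec_eq_zero (h.nonsingular p hp).ne_zero hker
  have := congrFun hc (Sum.inl i)
  simp [effCoeff] at this

end Model

end Deconv

namespace Deconv

/-! ### Calculus of boundedness in probability -/

section BoundedInProb

variable {Ω : Type*} [MeasurableSpace Ω] {P : Measure Ω} {f f' : ℕ → Ω → ℝ}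

/-- Boundedness in probability of a sequence of random variables. -/
def BoundedInProb (P : Measure Ω) (f : ℕ → Ω → ℝ) : Prop :=
  ∀ δ : ENNReal, 0 < δ → ∃ C : ℝ, ∀ᶠ n in atTop, P {ω | C ≤ |f n ω|} ≤ δ

lemma BoundedInProb.add (hf : BoundedInProb P f) (hf' : BoundedInProb P f') :
    BoundedInProb P fun n ω => f n ω + f' n ω := by
  intro δ hδ
  obtain ⟨C, hC⟩ := hf (δ / 2) (ENNReal.half_pos hδ.ne')
  obtain ⟨C', hC'⟩ := hf' (δ / 2) (ENNReal.half_pos hδ.ne')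
  refine ⟨C + C', ?_⟩
  filter_upwards [hC, hC'] with n h h'
  calc P {ω | C + C' ≤ |f n ω + f' n ω|}
      ≤ P ({ω | C ≤ |f n ω|} ∪ {ω | C' ≤ |f' n ω|}) := by
        refine measure_mono fun ω hω => ?_
        by_contra hcon
        simp only [mem_union, mem_ofPred_eq, not_or, not_le] at hcon hω
        linarith [abs_add_le (f n ω) (f' n ω)]
    _ ≤ δ / 2 + δ / 2 := (measure_union_le _ _).trans (add_le_add h h')
    _ = δ := ENNReal.add_halves δ

lemma BoundedInProb.mul (hf : BoundedInProb P f) (hf' : BoundedInProb P f') :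
    BoundedInProb P fun n ω => f n ω * f' n ω := by
  intro δ hδ
  obtain ⟨C, hC⟩ := hf (δ / 2) (ENNReal.half_pos hδ.ne')
  obtain ⟨C', hC'⟩ := hf' (δ / 2) (ENNReal.half_pos hδ.ne')
  refine ⟨max C 1 * max C' 1, ?_⟩
  filter_upwards [hC, hC'] with n h h'
  calc P {ω | max C 1 * max C' 1 ≤ |f n ω * f' n ω|}
      ≤ P ({ω | C ≤ |f n ω|} ∪ {ω | C' ≤ |f' n ω|}) := by
        refine measure_mono fun ω hω => ?_
        by_contra hcon
        simp only [mem_union, mem_ofPred_eq, not_or, not_le] at hcon hω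
        rw [abs_mul] at hω
        exact absurd hω (not_le.2 (mul_lt_mul'' (lt_max_of_lt_left hcon.1)
          (lt_max_of_lt_left hcon.2) (abs_nonneg _) (abs_nonneg _)))
    _ ≤ δ / 2 + δ / 2 := (measure_union_le _ _).trans (add_le_add h h')
    _ = δ := ENNReal.add_halves δ

lemma BoundedInProb.sum {ι : Type*} {s : Finset ι} {u : ι → ℕ → Ω → ℝ}
    (h : ∀ i ∈ s, BoundedInProb P (u i)) : BoundedInProb P fun n ω => ∑ i ∈ s, u i n ω := by
  classical
  induction s using Finset.induction_on with
  | empty => exact fun δ _ => ⟨1, Eventually.of_forall fun n => by simp [not_le.2 one_pos]⟩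
  | insert a s ha ih =>
    simp_rw [Finset.sum_insert ha]
    exact (h a (Finset.mem_insert_self a s)).add
      (ih fun i hi => h i (Finset.mem_insert_of_mem hi))

lemma BoundedInProb.abs (hf : BoundedInProb P f) : BoundedInProb P fun n ω => |f n ω| := by
  simpa [BoundedInProb] using hf

lemma boundedInProb_of_tendsto_const {c : ℝ}
    (h : ∀ r : ℝ, 0 < r → Tendsto (fun n => P {ω | r ≤ |f n ω - c|}) atTop (𝓝 0)) :
    BoundedInProb P f := by
  intro δ hδ
  refine ⟨|c| + 1, ?_⟩
  filter_upwards [ENNReal.tendsto_nhds_zero.1 (h 1 one_pos) δ hδ] with n hn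
  refine (measure_mono fun ω hω => ?_).trans hn
  simp only [mem_ofPred_eq] at hω ⊢
  linarith [abs_sub_abs_le_abs_sub (f n ω) c]

lemma BoundedInProb.tendsto_measure_ge (hf : BoundedInProb P f) {a : ℕ → ℝ}
    (ha : Tendsto a atTop atTop) : Tendsto (fun n => P {ω | a n ≤ |f n ω|}) atTop (𝓝 0) := by
  refine ENNReal.tendsto_nhds_zero.2 fun δ hδ => ?_
  obtain ⟨C, hC⟩ := hf δ hδ
  filter_upwards [hC, ha.eventually_ge_atTop C] with n h h'
  exact (measure_mono fun ω hω => h'.trans hω).trans h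

end BoundedInProb

/-! ### Normalized sums of an i.i.d. sample -/

section Sample

variable {Ω : Type*} [MeasurableSpace Ω] {P : Measure Ω}
  {Y : ℕ → Ω → ℝ} {ν : Measure ℝ} {ψ : ℝ → ℝ}

/-- Transfers smallness under the product law to the underlying space. An inequality suffices, and
it holds for arbitrary `E`, so the exceptional events need not be measurable. -/
lemma measure_sample_le (hY : ∀ i, HasLaw (Y i) ν P) (hind : iIndepFun Y P) (n : ℕ)
    (E : Set (Fin n → ℝ)) :
    P {ω | (fun j : Fin n => Y j ω) ∈ E} ≤ Measure.pi (fun _ : Fin n => ν) E := by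
  have hm : ∀ j : Fin n, AEMeasurable (Y j) P := fun j => (hY j).aemeasurable
  have hind' : iIndepFun (fun (j : Fin n) => Y j) P := hind.precomp Fin.val_injective
  have hmap := hind'.map_fun_eq_pi_map hm
  simp_rw [(hY _).map_eq] at hmap
  rw [← hmap]
  exact Measure.le_map_apply (aemeasurable_pi_lambda _ hm) E

lemma integral_comp_sample (hY : ∀ i, HasLaw (Y i) ν P) (hψ : MemLp ψ 2 ν) (φ : ℝ → ℝ)
    (hφ : Continuous φ) (i : ℕ) : ∫ ω, φ (ψ (Y i ω)) ∂P = ∫ y, φ (ψ y) ∂ν :=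
  (hY i).integral_comp (f := fun y => φ (ψ y)) (hφ.comp_aestronglyMeasurable hψ.1)

lemma memLp_comp_sample (hY : ∀ i, HasLaw (Y i) ν P) (hψ : MemLp ψ 2 ν) (i : ℕ) :
    MemLp (fun ω => ψ (Y i ω)) 2 P := by
  have h : MemLp ψ 2 (P.map (Y i)) := by rwa [(hY i).map_eq]
  exact h.comp_of_map (hY i).aemeasurable

lemma iIndepFun_comp_sample (hY : ∀ i, HasLaw (Y i) ν P) (hind : iIndepFun Y P)
    (hψ : MemLp ψ 2 ν) : iIndepFun (fun i ω => ψ (Y i ω)) P :=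
  hind.comp₀ (fun _ => ψ) (fun i => (hY i).aemeasurable) fun i => by
    rw [(hY i).map_eq]; exact hψ.1.aemeasurable

/-- Equality holds for `n ≥ 1`; at `n = 0` the normalized sum is `0`, hence the inequality. -/
lemma variance_normSum_le (hY : ∀ i, HasLaw (Y i) ν P) (hind : iIndepFun Y P)
    (hψ : MemLp ψ 2 ν) (hψ0 : ∫ y, ψ y ∂ν = 0) (n : ℕ) :
    Var[fun ω => (1 / √(n : ℝ)) * ∑ j : Fin n, ψ (Y j ω); P] ≤ ∫ y, ψ y ^ 2 ∂ν := by
  have hL := memLp_comp_sample hY hψ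
  have hvar : ∀ i, Var[fun ω => ψ (Y i ω); P] = ∫ y, ψ y ^ 2 ∂ν := fun i => by
    rw [variance_eq_integral (hL i).1.aemeasurable,
      integral_comp_sample hY hψ (fun x => x) continuous_id i, hψ0]
    simpa using integral_comp_sample hY hψ (fun x => x ^ 2) (by fun_prop) i
  have hsum : Var[∑ j : Fin n, fun ω => ψ (Y j ω); P] = n * ∫ y, ψ y ^ 2 ∂ν := by
    rw [IndepFun.variance_sum (X := fun (j : Fin n) ω => ψ (Y j ω)) (fun j _ => hL j)
      fun i _ j _ hij => (iIndepFun_comp_sample hY hind hψ).indepFun fun h => hij (Fin.ext h)]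
    simp [hvar]
  have hfun : (fun ω => (1 / √(n : ℝ)) * ∑ j : Fin n, ψ (Y j ω)) =
      fun ω => (1 / √(n : ℝ)) * (∑ j : Fin n, fun ω => ψ (Y j ω)) ω := by
    ext ω; simp
  rw [hfun, variance_const_mul, hsum, div_pow, Real.sq_sqrt n.cast_nonneg]
  rcases n.eq_zero_or_pos with rfl | hn
  · simpa using integral_nonneg fun y => sq_nonneg (ψ y)
  · have : (0 : ℝ) < n := by exact_mod_cast hn
    apply le_of_eq
    field_simp

variable [IsProbabilityMeasure P]

lemma boundedInProb_normSum (hY : ∀ i, HasLaw (Y i) ν P) (hind : iIndepFun Y P)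
    (hψ : MemLp ψ 2 ν) (hψ0 : ∫ y, ψ y ∂ν = 0) :
    BoundedInProb P fun n ω => (1 / √(n : ℝ)) * ∑ j : Fin n, ψ (Y j ω) := by
  intro δ hδ
  have hlim : Tendsto (fun C : ℝ => ENNReal.ofReal ((∫ y, ψ y ^ 2 ∂ν) / C ^ 2)) atTop (𝓝 0) := by
    rw [← ENNReal.ofReal_zero]
    exact ENNReal.tendsto_ofReal
      (tendsto_const_nhds.div_atTop (tendsto_pow_atTop two_ne_zero))
  obtain ⟨C, hC, hCpos⟩ :=
    ((ENNReal.tendsto_nhds_zero.1 hlim δ hδ).and (eventually_gt_atTop 0)).exists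
  refine ⟨C, Eventually.of_forall fun n => ?_⟩
  have hL := memLp_comp_sample hY hψ
  have hLs : MemLp (fun ω => (1 / √(n : ℝ)) * ∑ j : Fin n, ψ (Y j ω)) 2 P :=
    (memLp_finsetSum _ fun (j : Fin n) _ => hL j).const_mul _
  have hmean : ∫ ω, (1 / √(n : ℝ)) * ∑ j : Fin n, ψ (Y j ω) ∂P = 0 := by
    rw [integral_const_mul, integral_finsetSum _ fun (j : Fin n) _ => (hL j).integrable one_le_two]
    simp [integral_comp_sample hY hψ (fun x => x) continuous_id, hψ0]
  have := meas_ge_le_variance_div_sq hLs hCpos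
  simp only [hmean, sub_zero] at this
  refine this.trans ((ENNReal.ofReal_le_ofReal ?_).trans hC)
  gcongr
  exact variance_normSum_le hY hind hψ hψ0 n

lemma tendstoInDistribution_normSum (hY : ∀ i, HasLaw (Y i) ν P) (hind : iIndepFun Y P)
    (hψ : MemLp ψ 2 ν) (hψ0 : ∫ y, ψ y ∂ν = 0) (hv : 0 < ∫ y, ψ y ^ 2 ∂ν) :
    TendstoInDistribution (fun (n : ℕ) ω => (1 / √(n : ℝ)) * ∑ j : Fin n, ψ (Y j ω)) atTop
      (fun z : Fin 1 → ℝ => √(∫ y, ψ y ^ 2 ∂ν) * z 0) (fun _ => P)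
      (Measure.pi fun _ : Fin 1 => gaussianReal 0 1) := by
  set v := ∫ y, ψ y ^ 2 ∂ν with hvdef
  have hz : HasLaw (fun z : Fin 1 → ℝ => z 0) (gaussianReal 0 1)
      (Measure.pi fun _ : Fin 1 => gaussianReal 0 1) :=
    (measurePreserving_eval (fun _ : Fin 1 => gaussianReal 0 1) 0).hasLaw
  -- The variables are standardized to unit variance; the factor `√v` is restored by a continuous
  -- map afterwards.
  have hclt := tendstoInDistribution_inv_sqrt_mul_sum (P := P) (X := fun i ω => (√v)⁻¹ * ψ (Y i ω))
    hz
    (by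
      have := integral_comp_sample hY hψ (fun x => (√v)⁻¹ * x) (by fun_prop) 0
      rw [this, integral_const_mul, hψ0, mul_zero])
    (by
      have := integral_comp_sample hY hψ (fun x => ((√v)⁻¹ * x) ^ 2) (by fun_prop) 0
      refine this.trans ?_
      simp only [mul_pow, integral_const_mul, inv_pow, Real.sq_sqrt hv.le]
      exact inv_mul_cancel₀ hv.ne')
    (iIndepFun_comp_sample (ψ := fun y => (√v)⁻¹ * ψ y) hY hind (hψ.const_mul (√v)⁻¹))
    (fun i => by
      have hid : IdentDistrib (Y i) (Y 0) P P :=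
        ⟨(hY i).aemeasurable, (hY 0).aemeasurable, by rw [(hY i).map_eq, (hY 0).map_eq]⟩
      refine hid.comp_of_aemeasurable (u := fun y => (√v)⁻¹ * ψ y) ?_
      rw [(hY i).map_eq]
      exact hψ.1.aemeasurable.const_mul _)
  have h2 := hclt.continuous_comp (g := fun x => √v * x) (by fun_prop)
  have hsv : √v ≠ 0 := (Real.sqrt_pos.2 hv).ne'
  refine h2.congr (fun n => ae_of_all _ fun ω => ?_) (ae_of_all _ fun z => rfl)
  simp only [Function.comp_apply, ← Finset.mul_sum]
  rw [Fin.sum_univ_eq_sum_range (fun j => ψ (Y j ω))]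
  field_simp

end Sample

/-! ### The selection rule: penalty comparison and measurability -/

section Selection

variable {d : ℕ} {w c : ℕ → ℝ}

lemma exists_penalized_max (hd : 1 ≤ d) (w c : ℕ → ℝ) :
    ∃ k, 1 ≤ k ∧ k ≤ d ∧ ∀ j, 1 ≤ j → j ≤ d → w j - c j ≤ w k - c k := by
  obtain ⟨k, hk, hmax⟩ := (Finset.Icc 1 d).exists_max_image (fun k => w k - c k)
    ⟨1, Finset.mem_Icc.2 ⟨le_rfl, hd⟩⟩
  rw [Finset.mem_Icc] at hk
  exact ⟨k, hk.1, hk.2, fun j h1 h2 => hmax j (Finset.mem_Icc.2 ⟨h1, h2⟩)⟩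

lemma selectionRule_spec (hd : 1 ≤ d) (w c : ℕ → ℝ) :
    1 ≤ selectionRule d w c ∧ selectionRule d w c ≤ d ∧
      ∀ j, 1 ≤ j → j ≤ d → w j - c j ≤ w (selectionRule d w c) - c (selectionRule d w c) :=
  Nat.sInf_mem (exists_penalized_max hd w c)

/-- Compare the selected dimension with dimension `1`. Absolute values enter because the estimated
matrices need not be positive semidefinite, so the statistics may be negative. -/
lemma exists_le_abs_of_one_lt_selectionRule (hd : 1 ≤ d) (h : 1 < selectionRule d w c) :
    ∃ k ∈ Finset.Icc 2 d, c k - c 1 ≤ |(|w k| + |w 1|)| := by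
  obtain ⟨_, h2, h3⟩ := selectionRule_spec hd w c
  refine ⟨selectionRule d w c, Finset.mem_Icc.2 ⟨h, h2⟩, ?_⟩
  have := h3 1 le_rfl hd
  rw [abs_of_nonneg (by positivity)]
  linarith [le_abs_self (w (selectionRule d w c)), neg_abs_le (w 1)]

lemma selectionRule_congr {w' : ℕ → ℝ} (h : ∀ k, 1 ≤ k → k ≤ d → w k = w' k) :
    selectionRule d w c = selectionRule d w' c := by
  unfold selectionRule
  congr 1
  ext k
  refine and_congr_right fun h1 => and_congr_right fun h2 => forall_congr' fun j =>
    forall_congr' fun h3 => forall_congr' fun h4 => ?_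
  rw [h k h1 h2, h j h3 h4]

lemma measurable_selectionRule (hd : 1 ≤ d) (c : ℕ → ℝ) :
    Measurable fun w : ℕ → ℝ => selectionRule d w c := by
  classical
  have heq : (fun w : ℕ → ℝ => selectionRule d w c) =
      fun w => Nat.find (exists_penalized_max hd w c) := by
    ext w
    exact le_antisymm (Nat.sInf_le (Nat.find_spec (exists_penalized_max hd w c)))
      (Nat.find_min' _ (selectionRule_spec hd w c))
  rw [heq]
  refine measurable_find _ fun k => ?_
  have hset : {w : ℕ → ℝ | 1 ≤ k ∧ k ≤ d ∧ ∀ j, 1 ≤ j → j ≤ d → w j - c j ≤ w k - c k} =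
      {_w | 1 ≤ k} ∩ ({_w | k ≤ d} ∩ ⋂ j, ⋂ (_ : 1 ≤ j), ⋂ (_ : j ≤ d),
        {w : ℕ → ℝ | w j - c j ≤ w k - c k}) := by
    ext w; simp
  rw [hset]
  refine (MeasurableSet.const _).inter ((MeasurableSet.const _).inter ?_)
  refine MeasurableSet.iInter fun j => MeasurableSet.iInter fun _ => MeasurableSet.iInter fun _ => ?_
  exact measurableSet_le (by fun_prop) (by fun_prop)

lemma measurable_apply_selectionRule (hd : 1 ≤ d) (c : ℕ → ℝ) :
    Measurable fun w : ℕ → ℝ => w (selectionRule d w c) := by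
  have h : Measurable fun x : ℕ × (ℕ → ℝ) => x.2 x.1 :=
    measurable_from_prod_countable_right fun k => measurable_pi_apply k
  exact h.comp ((measurable_selectionRule hd c).prodMk measurable_id)

/-- The rule reads only the indices `1, …, d`, so the other statistics can be set to `0` before
composing with a measurable map on sequences. -/
lemma aemeasurable_apply_selectionRule {Ω : Type*} [MeasurableSpace Ω] {P : Measure Ω}
    (hd : 1 ≤ d) (c : ℕ → ℝ) {V : ℕ → Ω → ℝ}
    (hV : ∀ k, 1 ≤ k → k ≤ d → AEMeasurable (V k) P) :
    AEMeasurable (fun ω => V (selectionRule d (fun k => V k ω) c) ω) P := by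
  classical
  have h : AEMeasurable (fun ω (k : ℕ) => if 1 ≤ k ∧ k ≤ d then V k ω else 0) P := by
    refine aemeasurable_pi_lambda _ fun k => ?_
    by_cases hk : 1 ≤ k ∧ k ≤ d
    · simpa only [if_pos hk] using hV k hk.1 hk.2
    · simpa only [if_neg hk] using aemeasurable_const
  refine ((measurable_apply_selectionRule hd c).comp_aemeasurable h).congr
    (ae_of_all _ fun ω => ?_)
  obtain ⟨h1, h2, -⟩ := selectionRule_spec hd (fun k => V k ω) c
  have hs : selectionRule d (fun k => if 1 ≤ k ∧ k ≤ d then V k ω else 0) c =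
      selectionRule d (fun k => V k ω) c :=
    selectionRule_congr fun k hk1 hk2 => by simp [hk1, hk2]
  simp only [Function.comp_apply, hs, h1, h2, and_self, if_true]

end Selection

end Deconv

namespace Deconv

/-! ### Asymptotics of the score statistics -/

section ScoreStatistic

variable {k m : ℕ} {F : SignalFamily k} {H : ErrorFamily m}
  {p : (Fin k → ℝ) × (Fin m → ℝ)} {Ω : Type*} [MeasurableSpace Ω] {P : Measure Ω}
  {Y : ℕ → Ω → ℝ} {l : (n : ℕ) → (Fin n → ℝ) → Fin n → Fin k → ℝ}
  {L : (n : ℕ) → (Fin n → ℝ) → Matrix (Fin k) (Fin k) ℝ}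

lemma hasLaw_obs (hp : p ∈ params F H) [IsFiniteMeasure P] {X ε : Ω → ℝ}
    (hX : HasLaw X (lawOf (F.f p.1)) P) (hε : HasLaw ε (lawOf (H.h p.2)) P)
    (hXε : IndepFun X ε P) : HasLaw (fun ω => X ω + ε ω) (G F H p) P := by
  have := (F.isDensity _ hp.1).isProbabilityMeasure_lawOf
  have := (H.isDensity _ hp.2).isProbabilityMeasure_lawOf
  rw [← conv_lawOf_eq_G hp]
  exact hXε.hasLaw_add hX hε

lemma measurable_normSum (n : ℕ) (hl : Measurable (l n)) :
    Measurable fun y => normSum (l n y) := by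
  unfold normSum
  fun_prop

lemma measurable_scoreStat (n : ℕ) (hl : Measurable (l n))
    (hL : ∀ i j, Measurable fun y => L n y i j) :
    Measurable fun y => scoreStat (l n y) (L n y) := by
  have h := measurable_normSum n hl
  unfold scoreStat
  simp only [dotProduct, mulVec]
  fun_prop

/-- The normalized sum of the estimated efficient scores is asymptotically equivalent to the
normalized sum of the efficient scores. -/
lemma SufficientlyGoodAt.tendsto_normSum_sub (h : SufficientlyGoodAt F H p l)
    (hY : ∀ i, HasLaw (Y i) (G F H p) P) (hind : iIndepFun Y P) (i : Fin k) (r : ℝ) (hr : 0 < r) :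
    Tendsto (fun n => P {ω | r ≤ |normSum (l n fun j => Y j ω) i -
      (1 / √(n : ℝ)) * ∑ j : Fin n, effScore F H p (Y j ω) i|}) atTop (𝓝 0) := by
  refine tendsto_of_tendsto_of_tendsto_of_le_of_le tendsto_const_nhds (h r hr)
    (fun n => zero_le) fun n => ?_
  refine (measure_mono fun ω hω => ?_).trans (measure_sample_le hY hind n _)
  simp only [mem_ofPred_eq] at hω ⊢
  refine hω.trans ?_
  have heq : normSum (l n fun j => Y j ω) i -
      (1 / √(n : ℝ)) * ∑ j : Fin n, effScore F H p (Y j ω) i = (1 / √(n : ℝ)) *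
      (WithLp.toLp 2 (∑ j, (l n (fun j => Y j ω) j - effScore F H p (Y j ω)))) i := by
    simp [normSum, mul_sub]
  rw [heq, abs_mul, abs_of_nonneg (by positivity)]
  gcongr
  exact PiLp.norm_apply_le (p := 2)
    (WithLp.toLp 2 (∑ j, (l n (fun j => Y j ω) j - effScore F H p (Y j ω)))) i

lemma ConsistentAt.tendsto_sample (h : ConsistentAt F H p L)
    (hY : ∀ i, HasLaw (Y i) (G F H p) P) (hind : iIndepFun Y P) (i j : Fin k) (r : ℝ)
    (hr : 0 < r) :
    Tendsto (fun n => P {ω | r ≤ |L n (fun j => Y j ω) i j - (effFisher F H p)⁻¹ i j|})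
      atTop (𝓝 0) :=
  tendsto_of_tendsto_of_tendsto_of_le_of_le tendsto_const_nhds (h i j r hr)
    (fun _ => zero_le) fun _ => measure_sample_le hY hind _ _

/-- The statistic is a finite sum of products of entries of the normalized sum and of `L`, each
bounded in probability. -/
lemma boundedInProb_scoreStat [IsProbabilityMeasure P] (hreg : IsRegular F H)
    (hp : p ∈ params F H) (hl : SufficientlyGoodAt F H p l) (hL : ConsistentAt F H p L)
    (hY : ∀ i, HasLaw (Y i) (G F H p) P) (hind : iIndepFun Y P) :
    BoundedInProb P fun n ω => scoreStat (l n fun j => Y j ω) (L n fun j => Y j ω) := by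
  have hN : ∀ i, BoundedInProb P fun n ω => normSum (l n fun j => Y j ω) i := fun i => by
    have h1 := boundedInProb_normSum hY hind (hreg.memLp_effScore hp i)
      (hreg.integral_effScore hp i)
    have h2 := boundedInProb_of_tendsto_const (P := P) (c := 0)
      (f := fun n ω => normSum (l n fun j => Y j ω) i -
        (1 / √(n : ℝ)) * ∑ j : Fin n, effScore F H p (Y j ω) i)
      (by simpa only [sub_zero] using hl.tendsto_normSum_sub hY hind i)
    simpa using h1.add h2
  have hLb : ∀ i j, BoundedInProb P fun n ω => L n (fun j => Y j ω) i j := fun i j =>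
    boundedInProb_of_tendsto_const (hL.tendsto_sample hY hind i j)
  simp only [scoreStat, dotProduct, mulVec]
  exact BoundedInProb.sum fun i _ => (hN i).mul
    (BoundedInProb.sum fun j _ => (hLb i j).mul (hN j))

end ScoreStatistic

/-- The efficient score statistic of a one-dimensional model is asymptotically chi-square
distributed with one degree of freedom. -/
lemma tendstoInDistribution_scoreStat_one {m : ℕ} {F : SignalFamily 1} {H : ErrorFamily m}
    {p : (Fin 1 → ℝ) × (Fin m → ℝ)} {Ω : Type*} [MeasurableSpace Ω] {P : Measure Ω}
    [IsProbabilityMeasure P] {Y : ℕ → Ω → ℝ} {l : (n : ℕ) → (Fin n → ℝ) → Fin n → Fin 1 → ℝ}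
    {L : (n : ℕ) → (Fin n → ℝ) → Matrix (Fin 1) (Fin 1) ℝ}
    (hreg : IsRegular F H) (hp : p ∈ params F H)
    (hl_meas : ∀ n, Measurable (l n)) (hL_meas : ∀ n i j, Measurable fun y => L n y i j)
    (hl : SufficientlyGoodAt F H p l) (hL : ConsistentAt F H p L)
    (hY : ∀ i, HasLaw (Y i) (G F H p) P) (hind : iIndepFun Y P) :
    TendstoInDistribution
      (fun n ω => scoreStat (l n fun j => Y j ω) (L n fun j => Y j ω)) atTop
      (fun z : Fin 1 → ℝ => ∑ i, z i ^ 2) (fun _ => P)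
      (Measure.pi fun _ : Fin 1 => gaussianReal 0 1) := by
  have hpos := hreg.effFisher_diag_pos hp 0
  have hJ : ∫ y, effScore F H p y 0 ^ 2 ∂(G F H p) = effFisher F H p 0 0 := by
    simp [effFisher, sq]
  have hobs : ∀ n : ℕ, AEMeasurable (fun ω (j : Fin n) => Y j ω) P := fun n =>
    aemeasurable_pi_lambda _ fun j => (hY j).aemeasurable
  have hA := tendstoInDistribution_normSum hY hind (hreg.memLp_effScore hp 0)
    (hreg.integral_effScore hp 0) (hJ ▸ hpos)
  rw [hJ] at hA
  have hNm : ∀ n, AEMeasurable (fun ω => normSum (l n fun j => Y j ω) 0) P := fun n =>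
    ((measurable_pi_apply 0).comp (measurable_normSum n (hl_meas n))).comp_aemeasurable (hobs n)
  have hN : TendstoInDistribution (fun n ω => normSum (l n fun j => Y j ω) 0) atTop
      (fun z : Fin 1 → ℝ => √(effFisher F H p 0 0) * z 0) (fun _ => P)
      (Measure.pi fun _ : Fin 1 => gaussianReal 0 1) := by
    refine tendstoInDistribution_of_tendstoInMeasure_sub _ _ hA ?_ hNm
    refine tendstoInMeasure_iff_norm.2 fun r hr => ?_
    simpa using hl.tendsto_normSum_sub hY hind 0 r hr
  have hLc : TendstoInMeasure P (fun n ω => L n (fun j => Y j ω) 0 0) atTop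
      fun _ => (effFisher F H p)⁻¹ 0 0 :=
    tendstoInMeasure_iff_norm.2 fun r hr => hL.tendsto_sample hY hind 0 0 r hr
  -- Slutsky: the statistic is a continuous function of the asymptotically normal sum and the
  -- consistent matrix entry.
  have hfin := hN.continuous_comp_prodMk_of_tendstoInMeasure_const
    (g := fun x : ℝ × ℝ => x.1 * (x.2 * x.1)) (by fun_prop) hLc
    (fun n => (hL_meas n 0 0).comp_aemeasurable (hobs n))
  refine hfin.congr (fun n => ae_of_all _ fun ω => ?_) (ae_of_all _ fun z => ?_)
  · simp [scoreStat, mulVec, dotProduct]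
  · have h1 : (effFisher F H p)⁻¹ 0 0 = (effFisher F H p 0 0)⁻¹ := by
      simp [Matrix.inv_subsingleton]
    have h2 := Real.mul_self_sqrt hpos.le
    simp only [h1, Finset.univ_unique, Fin.default_eq_zero, Finset.sum_singleton]
    calc √(effFisher F H p 0 0) * z 0 * ((effFisher F H p 0 0)⁻¹ * (√(effFisher F H p 0 0) * z 0))
        = (effFisher F H p 0 0)⁻¹ * (√(effFisher F H p 0 0) * √(effFisher F H p 0 0)) * z 0 ^ 2 := by
          ring
      _ = z 0 ^ 2 := by rw [h2, inv_mul_cancel₀ hpos.ne', one_mul]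

/-- Convergence in distribution depends on the limit only through its law; this passes from the
Gaussian space to `chiSquare 1`, which is by definition such an image law. -/
lemma tendstoInDistribution_id_map {Ω Ω' E : Type*} [MeasurableSpace Ω] [MeasurableSpace Ω']
    [TopologicalSpace E] [MeasurableSpace E] [OpensMeasurableSpace E] {P : Measure Ω}
    [IsProbabilityMeasure P] {Q : Measure Ω'} [IsProbabilityMeasure Q] {V : ℕ → Ω → E}
    {Z : Ω' → E} (h : TendstoInDistribution V atTop Z (fun _ => P) Q)
    [IsProbabilityMeasure (Q.map Z)] :
    TendstoInDistribution V atTop id (fun _ => P) (Q.map Z) where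
  forall_aemeasurable := h.forall_aemeasurable
  aemeasurable_limit := aemeasurable_id
  tendsto := by
    convert h.tendsto using 2
    exact congrArg 𝓝 (Subtype.ext Measure.map_id)

/-- If all the statistics are bounded in probability, the selection rule chooses the smallest
model with probability tending to one. -/
lemma tendsto_measure_one_lt_selectionRule {d : ℕ} (hd : 1 ≤ d) {pen : ℕ → ℕ → ℝ}
    (hpen : IsPenalty d pen) {Ω : Type*} [MeasurableSpace Ω] {P : Measure Ω}
    {W : (k n : ℕ) → Ω → ℝ} (hW : ∀ k, 1 ≤ k → k ≤ d → BoundedInProb P (W k)) :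
    Tendsto (fun n => P {ω | 1 < selectionRule d (fun k => W k n ω) (fun k => pen k n)})
      atTop (𝓝 0) := by
  have hsum : Tendsto (fun n => ∑ k ∈ Finset.Icc 2 d,
      P {ω | pen k n - pen 1 n ≤ |(|W k n ω| + |W 1 n ω|)|}) atTop (𝓝 0) := by
    rw [← Finset.sum_const_zero (s := Finset.Icc 2 d)]
    refine tendsto_finsetSum _ fun k hk => ?_
    obtain ⟨h2, hkd⟩ := Finset.mem_Icc.1 hk
    exact ((hW k (by omega) hkd).abs.add (hW 1 le_rfl hd).abs).tendsto_measure_ge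
      (hpen.tendsto k h2 hkd)
  refine tendsto_of_tendsto_of_tendsto_of_le_of_le tendsto_const_nhds hsum
    (fun n => zero_le) fun n => ?_
  refine (measure_mono fun ω hω => ?_).trans (measure_biUnion_finset_le _ _)
  obtain ⟨k, hk, h⟩ := exists_le_abs_of_one_lt_selectionRule hd hω
  exact mem_biUnion hk h

end Deconv

/-! ### The main theorem -/

theorem mainTheorem6 {d m : ℕ} (hd : 1 ≤ d)
    -- the nested family of submodels and the common family of error densities
    (F : (k : ℕ) → Deconv.SignalFamily k) (H : Deconv.ErrorFamily m)
    (hnested : Deconv.IsNested d F)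
    (hreg : ∀ k, 1 ≤ k → k ≤ d → Deconv.IsRegular (F k) H)
    -- the null hypothesis: the signal density is `f₀`, at the parameter `θ₀ k` of the `k`-th model
    (f₀ : ℝ → ℝ) (θ₀ : (k : ℕ) → Fin k → ℝ)
    (hθ₀ : ∀ k, 1 ≤ k → k ≤ d → θ₀ k ∈ (F k).Θ ∧ (F k).f (θ₀ k) = f₀)
    -- the true value of the nuisance parameter
    (η₀ : Fin m → ℝ) (hη₀ : η₀ ∈ H.Λ)
    -- the estimated efficient scores and the estimated inverse efficient information
    (l : (k n : ℕ) → (Fin n → ℝ) → Fin n → Fin k → ℝ)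
    (L : (k n : ℕ) → (Fin n → ℝ) → Matrix (Fin k) (Fin k) ℝ)
    (hl_meas : ∀ k, 1 ≤ k → k ≤ d → ∀ n, Measurable (l k n))
    (hL_meas : ∀ k, 1 ≤ k → k ≤ d → ∀ n i j, Measurable (fun y => L k n y i j))
    (hl : ∀ k, 1 ≤ k → k ≤ d → Deconv.SufficientlyGoodAt (F k) H (θ₀ k, η₀) (l k))
    (hL : ∀ k, 1 ≤ k → k ≤ d → Deconv.ConsistentAt (F k) H (θ₀ k, η₀) (L k))
    -- the penalty
    (pen : ℕ → ℕ → ℝ) (hpen : Deconv.IsPenalty d pen)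
    -- the signals `X i`, the errors `ε i` and the observations `Y i = X i + ε i`
    {Ω : Type*} [MeasurableSpace Ω] (P : Measure Ω) [IsProbabilityMeasure P]
    (X ε Y : ℕ → Ω → ℝ)
    (hX : ∀ i, HasLaw (X i) (Deconv.lawOf f₀) P)
    (hε : ∀ i, HasLaw (ε i) (Deconv.lawOf (H.h η₀)) P)
    (hXε : ∀ i, IndepFun (X i) (ε i) P)
    (hindep : iIndepFun (fun i ω => (X i ω, ε i ω)) P)
    (hY : ∀ i ω, Y i ω = X i ω + ε i ω)
    -- the test statistics `W k n` and the selection rule `S n`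
    (W : (k n : ℕ) → Ω → ℝ)
    (hW : ∀ k n ω, W k n ω =
      Deconv.scoreStat (l k n (fun j => Y j ω)) (L k n (fun j => Y j ω)))
    (S : ℕ → Ω → ℕ)
    (hS : ∀ n ω, S n ω = Deconv.selectionRule d (fun k => W k n ω) (fun k => pen k n)) :
    Tendsto (fun n => P {ω | 1 < S n ω}) atTop (𝓝 0) ∧
      TendstoInDistribution (fun n ω => W (S n ω) n ω) atTop id (fun _ => P)
        (Deconv.chiSquare 1) := by
  have hp : ∀ k, 1 ≤ k → k ≤ d → (θ₀ k, η₀) ∈ Deconv.params (F k) H := fun k h1 h2 =>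
    ⟨(hθ₀ k h1 h2).1, hη₀⟩
  have hYfun : Y = fun i ω => X i ω + ε i ω := funext fun i => funext fun ω => hY i ω
  have hind : iIndepFun Y P := by
    rw [hYfun]
    exact hindep.comp (fun _ x => x.1 + x.2) fun _ => by fun_prop
  have hlaw : ∀ k, 1 ≤ k → k ≤ d → ∀ i, HasLaw (Y i) (Deconv.G (F k) H (θ₀ k, η₀)) P := by
    intro k h1 h2 i
    rw [hYfun]
    refine Deconv.hasLaw_obs (hp k h1 h2) ?_ (hε i) (hXε i)
    simpa only [(hθ₀ k h1 h2).2] using hX i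
  have hWfun : ∀ k, W k = fun n ω =>
      Deconv.scoreStat (l k n (fun j => Y j ω)) (L k n (fun j => Y j ω)) := fun k =>
    funext fun n => funext fun ω => hW k n ω
  have hbdd : ∀ k, 1 ≤ k → k ≤ d → Deconv.BoundedInProb P (W k) := fun k h1 h2 => by
    rw [hWfun]
    exact Deconv.boundedInProb_scoreStat (hreg k h1 h2) (hp k h1 h2) (hl k h1 h2) (hL k h1 h2)
      (hlaw k h1 h2) hind
  have hSsel : Tendsto (fun n => P {ω | 1 < S n ω}) atTop (𝓝 0) := by
    simp_rw [hS]
    exact Deconv.tendsto_measure_one_lt_selectionRule hd hpen hbdd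
  refine ⟨hSsel, ?_⟩
  have hW1 : TendstoInDistribution (W 1) atTop (fun z : Fin 1 → ℝ => ∑ i, z i ^ 2) (fun _ => P)
      (Measure.pi fun _ : Fin 1 => gaussianReal 0 1) := by
    rw [hWfun]
    exact Deconv.tendstoInDistribution_scoreStat_one (hreg 1 le_rfl hd) (hp 1 le_rfl hd)
      (hl_meas 1 le_rfl hd) (hL_meas 1 le_rfl hd) (hl 1 le_rfl hd) (hL 1 le_rfl hd)
      (hlaw 1 le_rfl hd) hind
  have hWm : ∀ k, 1 ≤ k → k ≤ d → ∀ n, AEMeasurable (W k n) P := fun k h1 h2 n => by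
    rw [hWfun]
    exact (Deconv.measurable_scoreStat n (hl_meas k h1 h2 n) (hL_meas k h1 h2 n)).comp_aemeasurable
      (aemeasurable_pi_lambda _ fun j => (hlaw k h1 h2 j).aemeasurable)
  have hWS : TendstoInDistribution (fun n ω => W (S n ω) n ω) atTop
      (fun z : Fin 1 → ℝ => ∑ i, z i ^ 2) (fun _ => P)
      (Measure.pi fun _ : Fin 1 => gaussianReal 0 1) := by
    -- `W_S - W_1` vanishes on `S = 1`, so any deviation lies in the event `1 < S`, of vanishing
    -- probability.
    refine tendstoInDistribution_of_tendstoInMeasure_sub _ _ hW1 ?_ fun n => ?_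
    · refine tendstoInMeasure_iff_norm.2 fun r hr => ?_
      refine tendsto_of_tendsto_of_tendsto_of_le_of_le tendsto_const_nhds hSsel
        (fun n => zero_le) fun n => measure_mono fun ω hω => ?_
      by_contra hcon
      -- The set of maximizers is nonempty, which excludes the default value `0` of `sInf`.
      have h1 : 1 ≤ S n ω := by rw [hS]; exact (Deconv.selectionRule_spec hd _ _).1
      have hS1 : S n ω = 1 := le_antisymm (not_lt.1 hcon) h1
      simp only [mem_ofPred_eq, Pi.sub_apply, Pi.zero_apply, hS1, sub_self, norm_zero] at hω
      exact hr.not_ge hω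
    · simp_rw [hS]
      exact Deconv.aemeasurable_apply_selectionRule hd _ fun k h1 h2 => hWm k h1 h2 n
  have : IsProbabilityMeasure ((Measure.pi fun _ : Fin 1 => gaussianReal 0 1).map
      fun z : Fin 1 → ℝ => ∑ i, z i ^ 2) :=
    inferInstanceAs (IsProbabilityMeasure (Deconv.chiSquare 1))
  exact Deconv.tendstoInDistribution_id_map hWS
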